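/- Let $\eta>0$ and $P_N>0$. The regular perturbative channel (RPC) is the memoryless channel with complex input $\mathbf x$ and complex output $$\mathbf y=\mathbf x+j\eta|\mathbf x|^2\mathbf x+\mathbf n,$$ where $\mathbf n\sim\mathcal{CN}(0,P_N)$ is circularly symmetric complex Gaussian noise of variance $P_N$, independent of $\mathbf x$. For $P>0$ let $$\mathcal C_{\mathrm{RPC}}(P)=\sup I(\mathbf x;\mathbf y),$$ where $I$ denotes mutual information and the supremum is over all probability distributions of $\mathbf x$ on $\mathbb C$ with $\mathbb E[|\mathbf x|^2]\le P$. All logarithms are in base two (so information is measured in bits). Then $\mathcal C_{\mathrm{RPC}}(P)<\infty$ for every $P>0$, the limit $\lim_{P\to\infty}\left[\mathcal C_{\mathrm{RPC}}(P)-3\log P\right]$ exists in $\mathbb R$, and $$\log\frac{2\eta^2e^2}{9P_N}\;\le\;\lim_{P\to\infty}\left[\mathcal C_{\mathrm{RPC}}(P)-3\log P\right]\;\le\;\log\frac{6\eta^2}{P_N}.$$ Consequently the capacity pre-log of the RPC is $3$, i.e. $\lim_{P\to\infty}\mathcal C_{\mathrm{RPC}}(P)/\log P=3$. -/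

import Mathlib

open MeasureTheory ProbabilityTheory Filter
open scoped ENNReal Topology

/-- The circularly symmetric complex Gaussian law `CN(0, N)` of total variance `N`: the real and
imaginary parts are independent centred real Gaussians of variance `N / 2`. -/
noncomputable def complexGaussian (N : ℝ) : Measure ℂ :=
  ((gaussianReal 0 (N / 2).toNNReal).prod (gaussianReal 0 (N / 2).toNNReal)).map
    (fun p : ℝ × ℝ => (⟨p.1, p.2⟩ : ℂ))

/-- Input-output relation of the regular perturbative channel: `y = x + j η |x|² x + n`. -/
noncomputable def rpcOutput (η : ℝ) (x n : ℂ) : ℂ :=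
  x + Complex.I * (η : ℂ) * ((‖x‖ ^ 2 : ℝ) : ℂ) * x + n

/-- Joint law of the input `x` (with law `μ`) and the output `y` of the regular perturbative
channel, the noise `n` having law `CN(0, N)` and being independent of `x`. -/
noncomputable def rpcJointLaw (η N : ℝ) (μ : Measure ℂ) : Measure (ℂ × ℂ) :=
  (μ.prod (complexGaussian N)).map (fun p => (p.1, rpcOutput η p.1 p.2))

/-- Mutual information, in bits, of a pair of random variables with joint law `ρ`: the relative
entropy of the joint law with respect to the product of its marginals. Mathlib's `klDiv` uses the
natural logarithm, hence the division by `log 2`. -/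
noncomputable def mutualInfoBits {α β : Type*} [MeasurableSpace α] [MeasurableSpace β]
    (ρ : Measure (α × β)) : ℝ≥0∞ :=
  InformationTheory.klDiv ρ (ρ.fst.prod ρ.snd) / ENNReal.ofReal (Real.log 2)

/-- Capacity, in bits per channel use, of the regular perturbative channel under the average-power
constraint `E|x|² ≤ P`: the supremum of `I(x; y)` over all complex input laws. -/
noncomputable def rpcCapacity (η N P : ℝ) : ℝ≥0∞ :=
  ⨆ (μ : Measure ℂ) (_ : IsProbabilityMeasure μ)
    (_ : ∫⁻ x, ENNReal.ofReal (‖x‖ ^ 2) ∂μ ≤ ENNReal.ofReal P),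
      mutualInfoBits (rpcJointLaw η N μ)

/-- `d` is the capacity pre-log of a channel whose capacity at power `P` is `C P` bits:
`C P / log₂ P → d` as `P → ∞`. -/
def IsCapacityPreLog (C : ℝ → ℝ) (d : ℝ) : Prop :=
  Tendsto (fun P => C P / Real.logb 2 P) atTop (𝓝 d)

/-! Write `g` for `rpcMap η`, so `y = g x + n`. Since `|g x|` grows like `η|x|³`, the power `E|x|²`
becomes, to leading order, a moment of order `2/3` of `g x`. Under such a moment constraint entropy
is maximal for a density proportional to `exp (-b |z| ^ (2/3))`.

Upper bound: replacing the output law by this maximizer can only increase the divergence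
(`klDiv_fst_prod_snd_le`), and the result is an explicit integral. Lower bound: `g` is a bijection,
so some input makes `g x` itself have the maximizing law; independent noise does not lower entropy,
which here takes the form of a Donsker–Varadhan test function.

Both bounds equal `log (2 e² M³ / (9 N))`, with `M = outputMomentBound η N P` above and `M = η ^
(2/3) * P` below. As the two values of `M / P` share the limit `η ^ (2/3)`, the limit is exactly the
stated lower bound, and the stated upper bound reduces to `e² ≤ 27`. -/

/-! ### Variational bounds for relative entropy -/

/-- A consequence of the Donsker–Varadhan variational formula. -/
theorem ofReal_integral_le_klDiv {α : Type*} [MeasurableSpace α] {ρ π : Measure α}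
    [IsProbabilityMeasure ρ] [IsProbabilityMeasure π] {f : α → ℝ}
    (hfρ : Integrable f ρ) (hf : Integrable (fun x => Real.exp (f x)) π)
    (hf1 : ∫ x, Real.exp (f x) ∂π = 1) :
    ENNReal.ofReal (∫ x, f x ∂ρ) ≤ InformationTheory.klDiv ρ π := by
  by_cases htop : InformationTheory.klDiv ρ π = ∞
  · simp [htop]
  obtain ⟨hac, hint⟩ := InformationTheory.klDiv_ne_top_iff.1 htop
  have : IsProbabilityMeasure (π.tilted f) := isProbabilityMeasure_tilted hf
  have h1 := integral_llr_tilted_right hac hfρ hf hint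
  -- Gibbs' inequality for `ρ` against the tilted probability measure.
  have h2 := InformationTheory.integral_llr_add_sub_measure_univ_nonneg
    (hac.trans (absolutelyContinuous_tilted hf)) (integrable_llr_tilted_right hac hfρ hint hf)
  rw [InformationTheory.klDiv_of_ac_of_integrable hac hint]
  apply ENNReal.ofReal_le_ofReal
  rw [h1, hf1] at h2
  simp only [Real.log_one, probReal_univ] at h2 ⊢
  linarith

theorem klDiv_withDensity_exp {α : Type*} [MeasurableSpace α] {ρ π : Measure α}
    [IsProbabilityMeasure ρ] [IsProbabilityMeasure π] {f : α → ℝ} (hf : Measurable f)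
    (hρ : ρ = π.withDensity (fun x => ENNReal.ofReal (Real.exp (f x)))) (hint : Integrable f ρ) :
    InformationTheory.klDiv ρ π = ENNReal.ofReal (∫ x, f x ∂ρ) := by
  have hac : ρ ≪ π := by rw [hρ]; exact withDensity_absolutelyContinuous _ _
  have hllr : llr ρ π =ᵐ[ρ] f := by
    apply hac.ae_le
    have := Measure.rnDeriv_withDensity π (f := fun x => ENNReal.ofReal (Real.exp (f x)))
      (by fun_prop)
    rw [← hρ] at this
    filter_upwards [this] with x hx
    simp [llr, hx, Real.exp_nonneg]
  rw [InformationTheory.klDiv_of_ac_of_integrable hac ((integrable_congr hllr).2 hint),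
    integral_congr_ae hllr]
  simp

theorem klDiv_map_swap {α β : Type*} [MeasurableSpace α] [MeasurableSpace β]
    (ρ π : Measure (α × β)) [IsFiniteMeasure ρ] [IsFiniteMeasure π] :
    InformationTheory.klDiv (ρ.map Prod.swap) (π.map Prod.swap) =
      InformationTheory.klDiv ρ π := by
  apply le_antisymm (InformationTheory.klDiv_map_le _ _ measurable_swap)
  have h := InformationTheory.klDiv_map_le (ρ.map Prod.swap) (π.map Prod.swap)
    (measurable_swap (α := β) (β := α))
  simpa [Measure.map_map measurable_swap measurable_swap] using h

/-- Among all product measures `ρ.fst × ν`, the divergence from `ρ` is smallest at `ν = ρ.snd`. -/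
theorem klDiv_fst_prod_snd_le {α β : Type*} [MeasurableSpace α] [StandardBorelSpace α] [Nonempty α]
    [MeasurableSpace β] (ρ : Measure (α × β)) [IsProbabilityMeasure ρ]
    (ν : Measure β) [IsProbabilityMeasure ν] :
    InformationTheory.klDiv ρ (ρ.fst.prod ρ.snd) ≤ InformationTheory.klDiv ρ (ρ.fst.prod ν) := by
  have : IsProbabilityMeasure (ρ.map Prod.swap) :=
    Measure.isProbabilityMeasure_map measurable_swap.aemeasurable
  -- After swapping, the chain rule splits off the divergence of `ρ.snd` from `ν`; the remaining
  -- term does not depend on `ν`.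
  rw [← klDiv_map_swap ρ (ρ.fst.prod ρ.snd), ← klDiv_map_swap ρ (ρ.fst.prod ν),
    Measure.prod_swap, Measure.prod_swap, ← Measure.compProd_const (μ := ρ.snd),
    ← Measure.compProd_const (μ := ν),
    ← Measure.disintegrate (ρ.map Prod.swap) (ρ.map Prod.swap).condKernel, Measure.fst_map_swap,
    InformationTheory.klDiv_compProd_eq_add _ ν]
  exact le_add_self

/-! ### Radial exponential laws on the plane -/

theorem Complex.integral_rpow_norm_mul_exp_neg_mul_rpow {p q b : ℝ} (hp : 0 < p) (hq : -2 < q)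
    (hb : 0 < b) :
    ∫ z : ℂ, ‖z‖ ^ q * Real.exp (-b * ‖z‖ ^ p) =
      2 * Real.pi / p * b ^ (-(q + 2) / p) * Real.Gamma ((q + 2) / p) := by
  have h := integral_fun_norm_addHaar (volume : Measure ℂ)
    (fun r : ℝ => r ^ q * Real.exp (-b * r ^ p))
  rw [Complex.finrank_real_complex] at h
  have h2 : ∫ y in Set.Ioi (0 : ℝ), y ^ (2 - 1) • (y ^ q * Real.exp (-b * y ^ p)) =
      ∫ y in Set.Ioi (0 : ℝ), y ^ (q + 1) * Real.exp (-b * y ^ p) := by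
    refine setIntegral_congr_fun measurableSet_Ioi fun y hy => ?_
    simp only [smul_eq_mul, Real.rpow_add_one (ne_of_gt hy : y ≠ 0)]
    ring
  rw [h, h2, _root_.integral_rpow_mul_exp_neg_mul_rpow hp (by linarith) hb,
    show q + 1 + 1 = q + 2 by ring]
  simp [Measure.real, Complex.volume_ball]
  ring

/-- Normalizing constant of the density proportional to `exp (-b ‖z‖ ^ p)` on `ℂ`. -/
noncomputable def radialMass (p b : ℝ) : ℝ :=
  2 * Real.pi / p * b ^ (-2 / p) * Real.Gamma (2 / p)

/-- Probability density on `ℂ` proportional to `exp (-b ‖z‖ ^ p)`. -/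
noncomputable def radialDensity (p b : ℝ) (z : ℂ) : ℝ :=
  Real.exp (-b * ‖z‖ ^ p) / radialMass p b

/-- Probability measure on `ℂ` with density proportional to `exp (-b ‖z‖ ^ p)`. -/
noncomputable def radialLaw (p b : ℝ) : Measure ℂ :=
  volume.withDensity fun z => ENNReal.ofReal (radialDensity p b z)

theorem radialMass_pos {p b : ℝ} (hp : 0 < p) (hb : 0 < b) : 0 < radialMass p b := by
  have := Real.Gamma_pos_of_pos (show 0 < 2 / p by positivity)
  have := Real.pi_pos
  unfold radialMass
  positivity

theorem radialDensity_pos {p b : ℝ} (hp : 0 < p) (hb : 0 < b) (z : ℂ) : 0 < radialDensity p b z :=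
  div_pos (Real.exp_pos _) (radialMass_pos hp hb)

theorem log_radialDensity {p b : ℝ} (hp : 0 < p) (hb : 0 < b) (z : ℂ) :
    Real.log (radialDensity p b z) = -b * ‖z‖ ^ p - Real.log (radialMass p b) := by
  rw [radialDensity, Real.log_div (Real.exp_ne_zero _) (radialMass_pos hp hb).ne', Real.log_exp]

theorem measurable_radialDensity (p b : ℝ) : Measurable (radialDensity p b) := by
  unfold radialDensity
  fun_prop

theorem integral_radialDensity {p b : ℝ} (hp : 0 < p) (hb : 0 < b) : ∫ z, radialDensity p b z = 1 := by
  have h := Complex.integral_rpow_norm_mul_exp_neg_mul_rpow hp (q := 0) (by norm_num) hb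
  simp only [Real.rpow_zero, one_mul, zero_add] at h
  simp only [radialDensity]
  rw [integral_div, h, ← radialMass, div_self (radialMass_pos hp hb).ne']

theorem lintegral_radialDensity {p b : ℝ} (hp : 0 < p) (hb : 0 < b) : ∫⁻ z, ENNReal.ofReal (radialDensity p b z) = 1 := by
  rw [← ofReal_integral_eq_lintegral_ofReal, integral_radialDensity hp hb, ENNReal.ofReal_one]
  -- A nonzero Bochner integral forces integrability, the default value being `0`.
  · refine not_imp_comm.1 integral_undef ?_
    rw [integral_radialDensity hp hb]
    norm_num
  · exact ae_of_all _ fun z => (radialDensity_pos hp hb z).le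

theorem isProbabilityMeasure_radialLaw {p b : ℝ} (hp : 0 < p) (hb : 0 < b) : IsProbabilityMeasure (radialLaw p b) :=
  ⟨by rw [radialLaw, withDensity_apply _ MeasurableSet.univ, Measure.restrict_univ,
    lintegral_radialDensity hp hb]⟩

theorem lintegral_radialLaw (p b : ℝ) {f : ℂ → ℝ≥0∞} (hf : Measurable f) :
    ∫⁻ z, f z ∂radialLaw p b = ∫⁻ z, ENNReal.ofReal (radialDensity p b z) * f z := by
  rw [radialLaw, lintegral_withDensity_eq_lintegral_mul _ _ hf]
  · rfl
  · exact (measurable_radialDensity _ _).ennreal_ofReal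

theorem integral_rpow_norm_radialLaw {p b : ℝ} (hp : 0 < p) (hb : 0 < b) : ∫ z, ‖z‖ ^ p ∂radialLaw p b = 2 / (p * b) := by
  rw [radialLaw, integral_withDensity_eq_integral_toReal_smul
    (measurable_radialDensity _ _).ennreal_ofReal (ae_of_all _ fun _ => ENNReal.ofReal_lt_top)]
  have h := Complex.integral_rpow_norm_mul_exp_neg_mul_rpow hp (q := p) (by linarith) hb
  have hM := radialMass_pos hp hb
  calc ∫ z, (ENNReal.ofReal (radialDensity p b z)).toReal • ‖z‖ ^ p
      = ∫ z : ℂ, ‖z‖ ^ p * Real.exp (-b * ‖z‖ ^ p) / radialMass p b := by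
        refine integral_congr_ae (ae_of_all _ fun z => ?_)
        simp only [ENNReal.toReal_ofReal (radialDensity_pos hp hb z).le, smul_eq_mul]
        rw [radialDensity]
        ring
    _ = 2 / (p * b) := by
        rw [integral_div, h, div_eq_iff hM.ne', radialMass,
          show (p + 2) / p = 2 / p + 1 by field_simp; ring,
          Real.Gamma_add_one (by positivity),
          show -(p + 2) / p = -2 / p + -1 by field_simp; ring,
          Real.rpow_add hb, Real.rpow_neg_one]
        field_simp

theorem integrable_rpow_norm_radialLaw {p b : ℝ} (hp : 0 < p) (hb : 0 < b) : Integrable (fun z => ‖z‖ ^ p) (radialLaw p b) := by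
  refine not_imp_comm.1 integral_undef ?_
  rw [integral_rpow_norm_radialLaw hp hb]
  positivity

theorem radialMass_two (N : ℝ) : radialMass 2 N⁻¹ = Real.pi * N := by
  norm_num [radialMass, Real.rpow_neg_one]

theorem radialMass_two_thirds {b : ℝ} (hb : 0 < b) : radialMass (2 / 3) b = 6 * Real.pi / b ^ 3 := by
  have h : Real.Gamma 3 = 2 := by
    have := Real.Gamma_nat_eq_factorial 2
    rw [show ((2 : ℕ) : ℝ) + 1 = 3 by norm_num] at this
    rw [this]
    norm_num
  have h3 : b ^ (-3 : ℝ) = (b ^ 3)⁻¹ := by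
    rw [Real.rpow_neg hb.le]
    norm_cast
  norm_num [radialMass, h, h3]
  ring

/-- Puts the noise (`p = 2`) and the entropy maximizer (`p = 2/3`) in one family, so one entropy
formula serves both. -/
theorem complexGaussian_eq_radialLaw {N : ℝ} (hN : 0 < N) :
    complexGaussian N = radialLaw 2 N⁻¹ := by
  have hv : (N / 2).toNNReal ≠ 0 := by simpa using hN
  have hm : (volume : Measure (ℝ × ℝ)).map Complex.measurableEquivRealProd.symm = volume :=
    Complex.volume_preserving_equiv_real_prod.symm.map_eq
  ext s hs
  rw [complexGaussian, gaussianReal_of_var_ne_zero _ hv,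
    prod_withDensity (measurable_gaussianPDF _ _) (measurable_gaussianPDF _ _)]
  change Measure.map Complex.measurableEquivRealProd.symm _ s = _
  rw [MeasurableEquiv.map_apply, withDensity_apply _ (Complex.measurableEquivRealProd.symm.measurable hs),
    radialLaw, withDensity_apply _ hs]
  conv_rhs => rw [← hm]
  rw [setLIntegral_map hs (measurable_radialDensity _ _).ennreal_ofReal
    Complex.measurableEquivRealProd.symm.measurable]
  refine lintegral_congr fun x => ?_
  have hr : ((N / 2).toNNReal : ℝ) = N / 2 := Real.coe_toNNReal _ (by positivity)
  have hn : ‖(⟨x.1, x.2⟩ : ℂ)‖ ^ (2 : ℝ) = x.1 ^ 2 + x.2 ^ 2 := by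
    rw [Real.rpow_two, Complex.sq_norm, Complex.normSq_mk]
    ring
  have he : Complex.measurableEquivRealProd.symm x = (⟨x.1, x.2⟩ : ℂ) := rfl
  rw [he, gaussianPDF, gaussianPDF, ← ENNReal.ofReal_mul (gaussianPDFReal_nonneg _ _ _),
    gaussianPDFReal, gaussianPDFReal, hr, radialDensity, radialMass_two, hn]
  congr 1
  rw [mul_mul_mul_comm, ← Real.exp_add, ← mul_inv, Real.mul_self_sqrt (by positivity)]
  rw [div_eq_mul_inv, mul_comm]
  congr 2
  · field_simp
    ring
  · field_simp

/-! ### The noiseless channel is a bijection -/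

/-- The noiseless regular perturbative channel `x ↦ x + j η |x|² x`. -/
noncomputable def rpcMap (η : ℝ) (x : ℂ) : ℂ :=
  x + Complex.I * (η : ℂ) * ((‖x‖ ^ 2 : ℝ) : ℂ) * x

theorem rpcOutput_eq (η : ℝ) (x n : ℂ) : rpcOutput η x n = rpcMap η x + n := rfl

theorem continuous_rpcMap (η : ℝ) : Continuous (rpcMap η) := by
  unfold rpcMap
  fun_prop

theorem rpcMap_eq_mul (η : ℝ) (x : ℂ) :
    rpcMap η x = x * (1 + ((η * ‖x‖ ^ 2 : ℝ) : ℂ) * Complex.I) := by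
  rw [rpcMap]
  push_cast
  ring

theorem norm_one_add_mul_I_sq (t : ℝ) : ‖(1 + (t : ℂ) * Complex.I)‖ ^ 2 = 1 + t ^ 2 := by
  rw [Complex.sq_norm, Complex.normSq_apply]
  simp
  ring

theorem norm_rpcMap_sq (η : ℝ) (x : ℂ) :
    ‖rpcMap η x‖ ^ 2 = ‖x‖ ^ 2 * (1 + (η * ‖x‖ ^ 2) ^ 2) := by
  rw [rpcMap_eq_mul, norm_mul, mul_pow, norm_one_add_mul_I_sq]

theorem one_add_mul_I_ne_zero (t : ℝ) : 1 + (t : ℂ) * Complex.I ≠ 0 := by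
  intro h
  have := norm_one_add_mul_I_sq t
  rw [h] at this
  simp at this
  nlinarith [sq_nonneg t]

/-- The output modulus is strictly increasing in the input modulus, so it determines `‖x‖`, and then
the nonzero factor multiplying `x`. -/
theorem injective_rpcMap (η : ℝ) : Function.Injective (rpcMap η) := by
  intro x y h
  have h1 : ‖x‖ ^ 2 * (1 + (η * ‖x‖ ^ 2) ^ 2) = ‖y‖ ^ 2 * (1 + (η * ‖y‖ ^ 2) ^ 2) := by
    rw [← norm_rpcMap_sq, ← norm_rpcMap_sq, h]
  have h2 : ‖x‖ ^ 2 = ‖y‖ ^ 2 := by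
    have mono : ∀ a b : ℝ, 0 ≤ a → a < b → a * (1 + (η * a) ^ 2) < b * (1 + (η * b) ^ 2) := by
      intro a b ha hab
      have : (η * a) ^ 2 ≤ (η * b) ^ 2 := by
        rw [mul_pow, mul_pow]
        gcongr
      nlinarith [sq_nonneg (η * a)]
    rcases lt_trichotomy (‖x‖ ^ 2) (‖y‖ ^ 2) with hlt | heq | hlt
    · exact absurd h1 (mono _ _ (by positivity) hlt).ne
    · exact heq
    · exact absurd h1 (mono _ _ (by positivity) hlt).ne'
  rw [rpcMap_eq_mul, rpcMap_eq_mul, h2] at h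
  exact mul_right_cancel₀ (one_add_mul_I_ne_zero _) h

/-- The intermediate value theorem supplies the input modulus `r`; dividing by the factor at `r`
recovers the input. -/
theorem surjective_rpcMap (η : ℝ) : Function.Surjective (rpcMap η) := by
  intro w
  let f : ℝ → ℝ := fun r => r * ‖(1 + ((η * r ^ 2 : ℝ) : ℂ) * Complex.I)‖
  have hf : ContinuousOn f (Set.Icc 0 ‖w‖) := by
    apply Continuous.continuousOn
    fun_prop
  have hge : ‖w‖ ≤ f ‖w‖ := by
    apply le_mul_of_one_le_right (norm_nonneg _)
    rw [← one_le_sq_iff₀ (norm_nonneg _), norm_one_add_mul_I_sq]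
    nlinarith [sq_nonneg (η * ‖w‖ ^ 2)]
  obtain ⟨r, hr, hfr⟩ := intermediate_value_Icc (norm_nonneg w) hf
    (show ‖w‖ ∈ Set.Icc (f 0) (f ‖w‖) from ⟨by simp [f], hge⟩)
  have h0 := one_add_mul_I_ne_zero (η * r ^ 2)
  refine ⟨w / (1 + ((η * r ^ 2 : ℝ) : ℂ) * Complex.I), ?_⟩
  have hn : ‖w / (1 + ((η * r ^ 2 : ℝ) : ℂ) * Complex.I)‖ = r := by
    rw [norm_div, ← hfr, div_eq_iff (norm_ne_zero_iff.2 h0)]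
  rw [rpcMap_eq_mul, hn, div_mul_cancel₀ _ h0]

/-! ### Moment estimates of order `2/3` -/

theorem cube_rpow_two_thirds {r : ℝ} (hr : 0 ≤ r) : (r ^ 3) ^ (2 / 3 : ℝ) = r ^ 2 := by
  rw [← Real.rpow_natCast, ← Real.rpow_mul hr, ← Real.rpow_two]
  norm_num

theorem norm_rpcMap_rpow_le {η : ℝ} (hη : 0 < η) (x : ℂ) :
    ‖rpcMap η x‖ ^ (2 / 3 : ℝ) ≤ ‖x‖ ^ (2 / 3 : ℝ) + η ^ (2 / 3 : ℝ) * ‖x‖ ^ 2 := by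
  have h : ‖rpcMap η x‖ ≤ ‖x‖ + η * ‖x‖ ^ 3 := by
    refine (norm_add_le _ _).trans_eq ?_
    simp [abs_of_pos hη]
    ring
  calc ‖rpcMap η x‖ ^ (2 / 3 : ℝ) ≤ (‖x‖ + η * ‖x‖ ^ 3) ^ (2 / 3 : ℝ) := by gcongr
    _ ≤ ‖x‖ ^ (2 / 3 : ℝ) + (η * ‖x‖ ^ 3) ^ (2 / 3 : ℝ) :=
        Real.rpow_add_le_add_rpow (by positivity) (by positivity) (by norm_num) (by norm_num)
    _ = _ := by
        rw [Real.mul_rpow hη.le (by positivity), cube_rpow_two_thirds (norm_nonneg _)]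

theorem le_norm_rpcMap_rpow {η : ℝ} (hη : 0 < η) (x : ℂ) :
    η ^ (2 / 3 : ℝ) * ‖x‖ ^ 2 ≤ ‖rpcMap η x‖ ^ (2 / 3 : ℝ) := by
  have h : η * ‖x‖ ^ 3 ≤ ‖rpcMap η x‖ := by
    apply le_of_sq_le_sq _ (norm_nonneg _)
    rw [norm_rpcMap_sq]
    nlinarith [sq_nonneg ‖x‖]
  rw [← cube_rpow_two_thirds (norm_nonneg x), ← Real.mul_rpow hη.le (by positivity)]
  gcongr

/-- Splitting at `‖x‖ ^ 2 = P` makes the mean at most `2 P ^ (1/3)` under the power constraint,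
negligible against `P`. -/
theorem norm_rpow_two_thirds_le {P : ℝ} (hP : 0 < P) (x : ℂ) :
    ‖x‖ ^ (2 / 3 : ℝ) ≤ P ^ (-(2 / 3) : ℝ) * ‖x‖ ^ 2 + P ^ (1 / 3 : ℝ) := by
  have hx : ‖x‖ ^ (2 / 3 : ℝ) = (‖x‖ ^ 2) ^ (1 / 3 : ℝ) := by
    rw [← Real.rpow_two, ← Real.rpow_mul (norm_nonneg _)]
    norm_num
  rw [hx]
  set t := ‖x‖ ^ 2 with ht
  have ht0 : 0 ≤ t := by positivity
  rcases le_total t P with h | h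
  · have : t ^ (1 / 3 : ℝ) ≤ P ^ (1 / 3 : ℝ) := by gcongr
    have : 0 ≤ P ^ (-(2 / 3) : ℝ) * t := by positivity
    linarith
  · have htp : 0 < t := hP.trans_le h
    have h1 : t ^ (1 / 3 : ℝ) = t ^ (-(2 / 3) : ℝ) * t := by
      rw [← Real.rpow_add_one htp.ne']
      norm_num
    have h2 : t ^ (-(2 / 3) : ℝ) ≤ P ^ (-(2 / 3) : ℝ) :=
      Real.rpow_le_rpow_of_nonpos hP h (by norm_num)
    have : 0 ≤ P ^ (1 / 3 : ℝ) := by positivity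
    rw [h1]
    nlinarith

theorem rpow_two_thirds_le_one_add_sq {r : ℝ} (hr : 0 ≤ r) :
    r ^ (2 / 3 : ℝ) ≤ 1 + r ^ (2 : ℝ) := by
  rcases le_total r 1 with h | h
  · have := Real.rpow_le_one hr h (show (0 : ℝ) ≤ 2 / 3 by norm_num)
    have : 0 ≤ r ^ (2 : ℝ) := by positivity
    linarith
  · have := Real.rpow_le_rpow_of_exponent_le h (show (2 / 3 : ℝ) ≤ 2 by norm_num)
    linarith

theorem norm_rpcMap_add_rpow_le {η P : ℝ} (hη : 0 < η) (hP : 0 < P) (x n : ℂ) :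
    ‖rpcMap η x + n‖ ^ (2 / 3 : ℝ) ≤
      (η ^ (2 / 3 : ℝ) + P ^ (-(2 / 3) : ℝ)) * ‖x‖ ^ 2 + (P ^ (1 / 3 : ℝ) + 1) +
        ‖n‖ ^ (2 : ℝ) := by
  have h1 : ‖rpcMap η x + n‖ ^ (2 / 3 : ℝ) ≤
      ‖rpcMap η x‖ ^ (2 / 3 : ℝ) + ‖n‖ ^ (2 / 3 : ℝ) :=
    (Real.rpow_le_rpow (norm_nonneg _) (norm_add_le _ _) (by norm_num)).trans
      (Real.rpow_add_le_add_rpow (norm_nonneg _) (norm_nonneg _) (by norm_num) (by norm_num))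
  have h2 := norm_rpcMap_rpow_le hη x
  have h3 := norm_rpow_two_thirds_le hP x
  have h4 := rpow_two_thirds_le_one_add_sq (norm_nonneg n)
  linarith

/-! ### The joint law and its densities -/

theorem measurable_rpcJoint (η : ℝ) :
    Measurable fun p : ℂ × ℂ => (p.1, rpcOutput η p.1 p.2) := by
  have := (continuous_rpcMap η).measurable
  simp only [rpcOutput_eq]
  fun_prop

theorem rpcJointLaw_eq (η : ℝ) {N : ℝ} (hN : 0 < N) (μ : Measure ℂ) :
    rpcJointLaw η N μ =
      (μ.prod (radialLaw 2 N⁻¹)).map fun p => (p.1, rpcOutput η p.1 p.2) := by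
  rw [rpcJointLaw, complexGaussian_eq_radialLaw hN]

theorem isProbabilityMeasure_rpcJointLaw (η : ℝ) {N : ℝ} (hN : 0 < N) (μ : Measure ℂ)
    [IsProbabilityMeasure μ] : IsProbabilityMeasure (rpcJointLaw η N μ) := by
  have := isProbabilityMeasure_radialLaw two_pos (inv_pos.2 hN)
  rw [rpcJointLaw_eq η hN]
  exact Measure.isProbabilityMeasure_map (measurable_rpcJoint η).aemeasurable

theorem fst_rpcJointLaw (η : ℝ) {N : ℝ} (hN : 0 < N) (μ : Measure ℂ) [IsProbabilityMeasure μ] :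
    (rpcJointLaw η N μ).fst = μ := by
  have := isProbabilityMeasure_radialLaw two_pos (inv_pos.2 hN)
  rw [rpcJointLaw_eq η hN, Measure.fst, Measure.map_map measurable_fst (measurable_rpcJoint η)]
  exact Measure.fst_prod

/-- Given `x`, the output is the noise translated by `rpcMap η x`, and Lebesgue measure is
translation invariant. -/
theorem lintegral_rpcJointLaw (η : ℝ) {N : ℝ} (hN : 0 < N) (μ : Measure ℂ)
    [IsProbabilityMeasure μ] {f : ℂ × ℂ → ℝ≥0∞} (hf : Measurable f) :
    ∫⁻ z, f z ∂rpcJointLaw η N μ =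
      ∫⁻ x, ∫⁻ y, ENNReal.ofReal (radialDensity 2 N⁻¹ (y - rpcMap η x)) * f (x, y) ∂volume ∂μ := by
  have := isProbabilityMeasure_radialLaw two_pos (inv_pos.2 hN)
  have hm := measurable_rpcJoint η
  have hfm : Measurable fun p : ℂ × ℂ => f (p.1, rpcOutput η p.1 p.2) := hf.comp hm
  rw [rpcJointLaw_eq η hN, lintegral_map hf hm, lintegral_prod _ hfm.aemeasurable]
  refine lintegral_congr fun x => ?_
  have hm2 : Measurable fun n : ℂ => f (x, rpcOutput η x n) :=
    hfm.comp measurable_prodMk_left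
  rw [lintegral_radialLaw _ _ hm2, ← lintegral_add_left_eq_self
    (fun y => ENNReal.ofReal (radialDensity 2 N⁻¹ (y - rpcMap η x)) * f (x, y)) (rpcMap η x)]
  simp [rpcOutput_eq]

theorem measurable_log_radialDensity (p b : ℝ) :
    Measurable fun z => Real.log (radialDensity p b z) :=
  Real.measurable_log.comp (measurable_radialDensity p b)

/-- The differential entropy of `radialLaw p b`, up to sign. -/
theorem integral_log_radialDensity_self {p b : ℝ} (hp : 0 < p) (hb : 0 < b) :
    Integrable (fun z => Real.log (radialDensity p b z)) (radialLaw p b) ∧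
      ∫ z, Real.log (radialDensity p b z) ∂radialLaw p b =
        -(2 / p) - Real.log (radialMass p b) := by
  have := isProbabilityMeasure_radialLaw hp hb
  have hi := (integrable_rpow_norm_radialLaw hp hb).const_mul (-b)
  simp only [log_radialDensity hp hb]
  refine ⟨hi.sub (integrable_const _), ?_⟩
  rw [integral_sub hi (integrable_const _), integral_const_mul,
    integral_rpow_norm_radialLaw hp hb]
  simp
  field_simp

theorem rpcJointLaw_eq_withDensity (η : ℝ) {N b : ℝ} (hN : 0 < N) (hb : 0 < b) (μ : Measure ℂ)
    [IsProbabilityMeasure μ] :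
    rpcJointLaw η N μ = (μ.prod (radialLaw (2 / 3) b)).withDensity fun z =>
      ENNReal.ofReal (Real.exp (Real.log (radialDensity 2 N⁻¹ (z.2 - rpcMap η z.1)) -
        Real.log (radialDensity (2 / 3) b z.2))) := by
  have := isProbabilityMeasure_radialLaw (show (0 : ℝ) < 2 / 3 by norm_num) hb
  have hg := (continuous_rpcMap η).measurable
  have hp := measurable_radialDensity 2 N⁻¹
  have hq := measurable_radialDensity (2 / 3) b
  refine Measure.ext_of_lintegral _ fun f hf => ?_
  rw [lintegral_rpcJointLaw η hN μ hf, lintegral_withDensity_eq_lintegral_mul _ (by fun_prop) hf,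
    lintegral_prod _ (by fun_prop)]
  refine lintegral_congr fun x => ?_
  rw [lintegral_radialLaw _ _ (by fun_prop)]
  refine lintegral_congr fun y => ?_
  have h1 := radialDensity_pos two_pos (inv_pos.2 hN) (y - rpcMap η x)
  have h2 := radialDensity_pos (show (0 : ℝ) < 2 / 3 by norm_num) hb y
  simp only [Pi.mul_apply]
  rw [← mul_assoc, ← ENNReal.ofReal_mul h2.le, Real.exp_sub, Real.exp_log h1, Real.exp_log h2,
    mul_div_cancel₀ _ h2.ne']

/-! ### Upper bound on mutual information -/

theorem integrable_norm_sq {μ : Measure ℂ} {P : ℝ} (hP : 0 ≤ P)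
    (hμ : ∫⁻ x, ENNReal.ofReal (‖x‖ ^ 2) ∂μ ≤ ENNReal.ofReal P) :
    Integrable (fun x => ‖x‖ ^ 2) μ ∧ ∫ x, ‖x‖ ^ 2 ∂μ ≤ P := by
  have h0 : 0 ≤ᵐ[μ] fun x : ℂ => ‖x‖ ^ 2 := ae_of_all _ fun x => by positivity
  have hm : AEStronglyMeasurable (fun x : ℂ => ‖x‖ ^ 2) μ := by fun_prop
  constructor
  · rw [← lintegral_ofReal_ne_top_iff_integrable hm h0]
    exact (hμ.trans_lt ENNReal.ofReal_lt_top).ne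
  · rw [integral_eq_lintegral_of_nonneg_ae h0 hm]
    exact ENNReal.toReal_le_of_le_ofReal hP hμ

/-- Bound on the moment of order `2 / 3` of the channel output at input power `P`. -/
noncomputable def outputMomentBound (η N P : ℝ) : ℝ :=
  (η ^ (2 / 3 : ℝ) + P ^ (-(2 / 3) : ℝ)) * P + (P ^ (1 / 3 : ℝ) + 1) + N

theorem integral_norm_output_rpow_le {η N P : ℝ} (hη : 0 < η) (hN : 0 < N) (hP : 0 < P)
    (μ : Measure ℂ) [IsProbabilityMeasure μ]
    (hμ : ∫⁻ x, ENNReal.ofReal (‖x‖ ^ 2) ∂μ ≤ ENNReal.ofReal P) :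
    Integrable (fun z : ℂ × ℂ => ‖rpcMap η z.1 + z.2‖ ^ (2 / 3 : ℝ))
        (μ.prod (radialLaw 2 N⁻¹)) ∧
      ∫ z, ‖rpcMap η z.1 + z.2‖ ^ (2 / 3 : ℝ) ∂(μ.prod (radialLaw 2 N⁻¹)) ≤
        outputMomentBound η N P := by
  have hN' := inv_pos.2 hN
  have := isProbabilityMeasure_radialLaw two_pos hN'
  have hg := (continuous_rpcMap η).measurable
  obtain ⟨hi, hle⟩ := integrable_norm_sq hP.le hμ
  have hn := integrable_rpow_norm_radialLaw two_pos hN'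
  set c := η ^ (2 / 3 : ℝ) + P ^ (-(2 / 3) : ℝ) with hc
  have h1 : Integrable (fun z : ℂ × ℂ => c * ‖z.1‖ ^ 2) (μ.prod (radialLaw 2 N⁻¹)) :=
    (hi.comp_fst _).const_mul c
  have h2 : Integrable (fun z : ℂ × ℂ => ‖z.2‖ ^ (2 : ℝ)) (μ.prod (radialLaw 2 N⁻¹)) :=
    hn.comp_snd _
  have h3 : Integrable (fun z : ℂ × ℂ => c * ‖z.1‖ ^ 2 + (P ^ (1 / 3 : ℝ) + 1))
      (μ.prod (radialLaw 2 N⁻¹)) := h1.add (integrable_const _)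
  have hint : Integrable (fun z : ℂ × ℂ => ‖rpcMap η z.1 + z.2‖ ^ (2 / 3 : ℝ))
      (μ.prod (radialLaw 2 N⁻¹)) := by
    have hm : Measurable fun z : ℂ × ℂ => ‖rpcMap η z.1 + z.2‖ ^ (2 / 3 : ℝ) := by fun_prop
    refine (h3.add h2).mono' hm.aestronglyMeasurable (ae_of_all _ fun z => ?_)
    rw [Real.norm_of_nonneg (by positivity)]
    exact norm_rpcMap_add_rpow_le hη hP z.1 z.2
  refine ⟨hint, ?_⟩
  refine (integral_mono hint (h3.add h2) fun z =>
    norm_rpcMap_add_rpow_le hη hP z.1 z.2).trans ?_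
  simp only [Pi.add_apply]
  have e1 : ∫ z : ℂ × ℂ, c * ‖z.1‖ ^ 2 ∂(μ.prod (radialLaw 2 N⁻¹)) = c * ∫ x, ‖x‖ ^ 2 ∂μ := by
    rw [integral_const_mul, integral_fun_fst (fun x : ℂ => ‖x‖ ^ 2)]
    simp
  have e2 : ∫ z : ℂ × ℂ, ‖z.2‖ ^ (2 : ℝ) ∂(μ.prod (radialLaw 2 N⁻¹)) = N := by
    rw [integral_fun_snd (fun x : ℂ => ‖x‖ ^ (2 : ℝ)), integral_rpow_norm_radialLaw two_pos hN']
    simp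
    field_simp
  rw [integral_add h3 h2, integral_add h1 (integrable_const _), e1, e2, outputMomentBound]
  simp only [integral_const, probReal_univ, one_smul]
  have : 0 ≤ c := by positivity
  have := mul_le_mul_of_nonneg_left hle this
  linarith

/-- The noise entropy is `1 + log (π N)`. The other bracket is the entropy of the `2/3` law, where
`b = 3 / M` makes the moment `2 / (p b)` equal to `M`. -/
theorem log_capacity_bound_eq {M N : ℝ} (hM : 0 < M) (hN : 0 < N) :
    -1 - Real.log (radialMass 2 N⁻¹) + (3 + Real.log (radialMass (2 / 3) (3 / M))) =
      Real.log (2 * Real.exp 1 ^ 2 * M ^ 3 / (9 * N)) := by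
  have hpi := Real.pi_pos
  rw [radialMass_two, radialMass_two_thirds (by positivity)]
  have h : 2 * Real.exp 1 ^ 2 * M ^ 3 / (9 * N) =
      Real.exp 2 * (6 * Real.pi / (3 / M) ^ 3 / (Real.pi * N)) := by
    rw [← Real.exp_nat_mul]
    norm_num
    field_simp
    norm_num
  rw [h, Real.log_mul (Real.exp_ne_zero _) (by positivity), Real.log_exp,
    Real.log_div (x := 6 * Real.pi / (3 / M) ^ 3) (by positivity) (by positivity)]
  ring

theorem outputMomentBound_pos {η N P : ℝ} (hη : 0 < η) (hN : 0 < N) (hP : 0 < P) :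
    0 < outputMomentBound η N P := by
  unfold outputMomentBound
  positivity

/-- The log-density of the test law is affine in `‖y‖ ^ (2/3)`, so its expectation needs only the
output moment bound. -/
theorem klDiv_rpcJointLaw_le {η N P : ℝ} (hη : 0 < η) (hN : 0 < N) (hP : 0 < P)
    (μ : Measure ℂ) [IsProbabilityMeasure μ]
    (hμ : ∫⁻ x, ENNReal.ofReal (‖x‖ ^ 2) ∂μ ≤ ENNReal.ofReal P) :
    InformationTheory.klDiv (rpcJointLaw η N μ)
        ((rpcJointLaw η N μ).fst.prod (rpcJointLaw η N μ).snd) ≤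
      ENNReal.ofReal
        (Real.log (2 * Real.exp 1 ^ 2 * outputMomentBound η N P ^ 3 / (9 * N))) := by
  have hM := outputMomentBound_pos hη hN hP
  set M := outputMomentBound η N P
  have hb : 0 < 3 / M := by positivity
  have h23 : (0 : ℝ) < 2 / 3 := by norm_num
  have hN' := inv_pos.2 hN
  have := isProbabilityMeasure_radialLaw two_pos hN'
  have := isProbabilityMeasure_radialLaw h23 hb
  have := isProbabilityMeasure_rpcJointLaw η hN μ
  have hg := (continuous_rpcMap η).measurable
  have hp := measurable_radialDensity 2 N⁻¹
  have hq := measurable_radialDensity (2 / 3) (3 / M)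
  refine (klDiv_fst_prod_snd_le _ (radialLaw (2 / 3) (3 / M))).trans ?_
  rw [fst_rpcJointLaw η hN]
  set F : ℂ × ℂ → ℝ := fun z => Real.log (radialDensity 2 N⁻¹ (z.2 - rpcMap η z.1)) -
        Real.log (radialDensity (2 / 3) (3 / M) z.2) with hF
  have hFm : Measurable F := by fun_prop
  obtain ⟨hoi, hole⟩ := integral_norm_output_rpow_le hη hN hP μ hμ
  obtain ⟨hni, hnv⟩ := integral_log_radialDensity_self two_pos hN'
  have hcomp : (fun z : ℂ × ℂ => F (z.1, rpcOutput η z.1 z.2)) = fun z =>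
      Real.log (radialDensity 2 N⁻¹ z.2) + (3 / M * ‖rpcMap η z.1 + z.2‖ ^ (2 / 3 : ℝ) +
        Real.log (radialMass (2 / 3) (3 / M))) := by
    ext z
    simp only [hF, rpcOutput_eq, add_sub_cancel_left, log_radialDensity h23 hb]
    ring
  have hi1 : Integrable (fun z : ℂ × ℂ => Real.log (radialDensity 2 N⁻¹ z.2))
      (μ.prod (radialLaw 2 N⁻¹)) := hni.comp_snd _
  have hi2 : Integrable (fun z : ℂ × ℂ => 3 / M * ‖rpcMap η z.1 + z.2‖ ^ (2 / 3 : ℝ))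
      (μ.prod (radialLaw 2 N⁻¹)) := hoi.const_mul _
  have hi3 : Integrable (fun z : ℂ × ℂ => 3 / M * ‖rpcMap η z.1 + z.2‖ ^ (2 / 3 : ℝ) +
        Real.log (radialMass (2 / 3) (3 / M))) (μ.prod (radialLaw 2 N⁻¹)) :=
    hi2.add (integrable_const _)
  have hint : Integrable F (rpcJointLaw η N μ) := by
    rw [rpcJointLaw_eq η hN, integrable_map_measure hFm.aestronglyMeasurable
      (measurable_rpcJoint η).aemeasurable]
    change Integrable (fun z : ℂ × ℂ => F (z.1, rpcOutput η z.1 z.2)) _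
    rw [hcomp]
    exact hi1.add hi3
  rw [klDiv_withDensity_exp hFm (rpcJointLaw_eq_withDensity η hN hb μ) hint]
  apply ENNReal.ofReal_le_ofReal
  rw [rpcJointLaw_eq η hN, integral_map (measurable_rpcJoint η).aemeasurable
    hFm.aestronglyMeasurable, hcomp, integral_add hi1 hi3, integral_add hi2 (integrable_const _),
    integral_fun_snd (fun z => Real.log (radialDensity 2 N⁻¹ z)), hnv, integral_const_mul,
    ← log_capacity_bound_eq hM hN]
  simp only [integral_const, probReal_univ, one_smul]
  have h3 : 3 / M * ∫ z, ‖rpcMap η z.1 + z.2‖ ^ (2 / 3 : ℝ) ∂(μ.prod (radialLaw 2 N⁻¹)) ≤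
      3 := by
    calc _ ≤ 3 / M * M := by gcongr
      _ = 3 := by field_simp
  linarith

/-! ### Lower bound from an explicit input -/

/-- The input law for which the noiseless output `rpcMap η x` has law `radialLaw (2 / 3) b`. -/
noncomputable def radialInput (η b : ℝ) : Measure ℂ :=
  (radialLaw (2 / 3) b).comap (rpcMap η)

theorem map_radialInput (η b : ℝ) :
    (radialInput η b).map (rpcMap η) = radialLaw (2 / 3) b := by
  rw [radialInput, ((continuous_rpcMap η).measurableEmbedding (injective_rpcMap η)).map_comap,
    (surjective_rpcMap η).range_eq, Measure.restrict_univ]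

theorem isProbabilityMeasure_radialInput (η : ℝ) {b : ℝ} (hb : 0 < b) :
    IsProbabilityMeasure (radialInput η b) := by
  have := isProbabilityMeasure_radialLaw (show (0 : ℝ) < 2 / 3 by norm_num) hb
  rw [← map_radialInput η b] at this
  exact Measure.isProbabilityMeasure_of_map (rpcMap η)

/-- `η ^ (2/3) * ‖x‖ ^ 2` is at most `‖rpcMap η x‖ ^ (2/3)`, whose mean is `3 / b = η ^ (2/3) * P`.
-/
theorem power_radialInput_le {η P : ℝ} (hη : 0 < η) (hP : 0 < P) :
    ∫⁻ x, ENNReal.ofReal (‖x‖ ^ 2) ∂radialInput η (3 / (η ^ (2 / 3 : ℝ) * P)) ≤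
      ENNReal.ofReal P := by
  have hc : 0 < η ^ (2 / 3 : ℝ) := by positivity
  have hb : 0 < 3 / (η ^ (2 / 3 : ℝ) * P) := by positivity
  have h23 : (0 : ℝ) < 2 / 3 := by norm_num
  set c := η ^ (2 / 3 : ℝ)
  calc ∫⁻ x, ENNReal.ofReal (‖x‖ ^ 2) ∂radialInput η (3 / (c * P))
      ≤ ∫⁻ x, ENNReal.ofReal (c⁻¹ * ‖rpcMap η x‖ ^ (2 / 3 : ℝ)) ∂radialInput η (3 / (c * P)) := by
        refine lintegral_mono fun x => ENNReal.ofReal_le_ofReal ?_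
        rw [le_inv_mul_iff₀ hc]
        exact le_norm_rpcMap_rpow hη x
    _ = ∫⁻ w, ENNReal.ofReal (c⁻¹ * ‖w‖ ^ (2 / 3 : ℝ)) ∂radialLaw (2 / 3) (3 / (c * P)) := by
        rw [← map_radialInput η, lintegral_map (by fun_prop) (continuous_rpcMap η).measurable]
    _ = ENNReal.ofReal P := by
        rw [← ofReal_integral_eq_lintegral_ofReal
          ((integrable_rpow_norm_radialLaw h23 hb).const_mul _)
          (ae_of_all _ fun w => by positivity), integral_const_mul,
          integral_rpow_norm_radialLaw h23 hb]
        congr 1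
        field_simp

theorem le_klDiv_rpcJointLaw_radialInput (η : ℝ) {N M : ℝ} (hN : 0 < N) (hM : 0 < M) :
    ENNReal.ofReal (Real.log (2 * Real.exp 1 ^ 2 * M ^ 3 / (9 * N))) ≤
      InformationTheory.klDiv (rpcJointLaw η N (radialInput η (3 / M)))
        ((rpcJointLaw η N (radialInput η (3 / M))).fst.prod
          (rpcJointLaw η N (radialInput η (3 / M))).snd) := by
  have hb : 0 < 3 / M := by positivity
  have h23 : (0 : ℝ) < 2 / 3 := by norm_num
  have hN' := inv_pos.2 hN
  have := isProbabilityMeasure_radialLaw two_pos hN'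
  have := isProbabilityMeasure_radialInput η hb
  have hmap := map_radialInput η (3 / M)
  set μ := radialInput η (3 / M)
  have := isProbabilityMeasure_rpcJointLaw η hN μ
  have hg := (continuous_rpcMap η).measurable
  have hp := measurable_radialDensity 2 N⁻¹
  have hq := measurable_radialDensity (2 / 3) (3 / M)
  rw [fst_rpcJointLaw η hN]
  set ν := (rpcJointLaw η N μ).snd
  -- The unknown output density is replaced by the density of the noiseless output at `rpcMap η
  -- z.1`, so the mean of `F` is a difference of known entropies.
  set F : ℂ × ℂ → ℝ := fun z => Real.log (radialDensity 2 N⁻¹ (z.2 - rpcMap η z.1)) -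
        Real.log (radialDensity (2 / 3) (3 / M) (rpcMap η z.1)) with hF
  have hFm : Measurable F := by fun_prop
  obtain ⟨hni, hnv⟩ := integral_log_radialDensity_self two_pos hN'
  obtain ⟨hqi, hqv⟩ := integral_log_radialDensity_self h23 hb
  have hgi : Integrable (fun x => Real.log (radialDensity (2 / 3) (3 / M) (rpcMap η x))) μ := by
    rw [← hmap] at hqi
    exact hqi.comp_measurable hg
  have hgv : ∫ x, Real.log (radialDensity (2 / 3) (3 / M) (rpcMap η x)) ∂μ =
      -(2 / (2 / 3)) - Real.log (radialMass (2 / 3) (3 / M)) := by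
    rw [← hqv, ← hmap, integral_map hg.aemeasurable
      (measurable_log_radialDensity _ _).aestronglyMeasurable]
  have hcomp : (fun z : ℂ × ℂ => F (z.1, rpcOutput η z.1 z.2)) = fun z =>
      Real.log (radialDensity 2 N⁻¹ z.2) -
        Real.log (radialDensity (2 / 3) (3 / M) (rpcMap η z.1)) := by
    ext z
    simp only [hF, rpcOutput_eq, add_sub_cancel_left]
  have hi1 : Integrable (fun z : ℂ × ℂ => Real.log (radialDensity 2 N⁻¹ z.2))
      (μ.prod (radialLaw 2 N⁻¹)) := hni.comp_snd _
  have hi2 : Integrable (fun z : ℂ × ℂ =>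
      Real.log (radialDensity (2 / 3) (3 / M) (rpcMap η z.1)))
      (μ.prod (radialLaw 2 N⁻¹)) := hgi.comp_fst _
  have hint : Integrable F (rpcJointLaw η N μ) := by
    rw [rpcJointLaw_eq η hN, integrable_map_measure hFm.aestronglyMeasurable
      (measurable_rpcJoint η).aemeasurable]
    change Integrable (fun z : ℂ × ℂ => F (z.1, rpcOutput η z.1 z.2)) _
    rw [hcomp]
    exact hi1.sub hi2
  -- With `y` fixed, integrating over `w = rpcMap η x` cancels the density of `w` and leaves the
  -- total mass of the noise density: the value is `1` whatever `ν` is.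
  have hlin : ∫⁻ z, ENNReal.ofReal (Real.exp (F z)) ∂(μ.prod ν) = 1 := by
    rw [lintegral_prod_symm _ (by fun_prop)]
    have hy : ∀ y, ∫⁻ x, ENNReal.ofReal (Real.exp (F (x, y))) ∂μ = 1 := by
      intro y
      have hw : ∀ w, ENNReal.ofReal (radialDensity (2 / 3) (3 / M) w) *
          ENNReal.ofReal (Real.exp (Real.log (radialDensity 2 N⁻¹ (y - w)) -
            Real.log (radialDensity (2 / 3) (3 / M) w))) =
          ENNReal.ofReal (radialDensity 2 N⁻¹ (y - w)) := by
        intro w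
        have h1 := radialDensity_pos two_pos hN' (y - w)
        have h2 := radialDensity_pos h23 hb w
        rw [← ENNReal.ofReal_mul h2.le, Real.exp_sub, Real.exp_log h1, Real.exp_log h2,
          mul_div_cancel₀ _ h2.ne']
      calc ∫⁻ x, ENNReal.ofReal (Real.exp (F (x, y))) ∂μ
          = ∫⁻ w, ENNReal.ofReal (Real.exp (Real.log (radialDensity 2 N⁻¹ (y - w)) -
              Real.log (radialDensity (2 / 3) (3 / M) w))) ∂radialLaw (2 / 3) (3 / M) := by
            rw [← hmap, lintegral_map (by fun_prop) hg]
        _ = ∫⁻ w, ENNReal.ofReal (radialDensity 2 N⁻¹ (y - w)) := by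
            rw [lintegral_radialLaw _ _ (by fun_prop)]
            exact lintegral_congr hw
        _ = 1 := by
            rw [lintegral_sub_left_eq_self (fun w => ENNReal.ofReal (radialDensity 2 N⁻¹ w)),
              lintegral_radialDensity two_pos hN']
    simp [hy]
  have hFexp : ∫ z, Real.exp (F z) ∂(μ.prod ν) = 1 := by
    rw [integral_eq_lintegral_of_nonneg_ae (ae_of_all _ fun z => (Real.exp_pos _).le)
      (by fun_prop), hlin, ENNReal.toReal_one]
  refine le_trans (ENNReal.ofReal_le_ofReal (le_of_eq ?_)) (ofReal_integral_le_klDiv hint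
    (not_imp_comm.1 integral_undef (by rw [hFexp]; norm_num)) hFexp)
  rw [rpcJointLaw_eq η hN, integral_map (measurable_rpcJoint η).aemeasurable
    hFm.aestronglyMeasurable, hcomp, integral_sub hi1 hi2,
    integral_fun_snd (fun z => Real.log (radialDensity 2 N⁻¹ z)), hnv,
    integral_fun_fst (fun x => Real.log (radialDensity (2 / 3) (3 / M) (rpcMap η x))), hgv,
    ← log_capacity_bound_eq hM hN]
  simp only [probReal_univ, one_smul]
  ring

/-! ### Capacity bounds and high-power asymptotics -/

theorem rpcCapacity_le {η N P : ℝ} (hη : 0 < η) (hN : 0 < N) (hP : 0 < P) :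
    rpcCapacity η N P ≤ ENNReal.ofReal
      (Real.log (2 * Real.exp 1 ^ 2 * outputMomentBound η N P ^ 3 / (9 * N))) /
        ENNReal.ofReal (Real.log 2) := by
  refine iSup_le fun μ => iSup_le fun hμ => iSup_le fun hμP => ?_
  exact ENNReal.div_le_div_right (klDiv_rpcJointLaw_le hη hN hP μ hμP) _

theorem le_rpcCapacity {η N P : ℝ} (hη : 0 < η) (hN : 0 < N) (hP : 0 < P) :
    ENNReal.ofReal
      (Real.log (2 * Real.exp 1 ^ 2 * (η ^ (2 / 3 : ℝ) * P) ^ 3 / (9 * N))) /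
        ENNReal.ofReal (Real.log 2) ≤ rpcCapacity η N P := by
  have hM : 0 < η ^ (2 / 3 : ℝ) * P := by positivity
  refine le_iSup_of_le (radialInput η (3 / (η ^ (2 / 3 : ℝ) * P))) <|
    le_iSup_of_le (isProbabilityMeasure_radialInput η (by positivity)) <|
    le_iSup_of_le (power_radialInput_le hη hP) ?_
  exact ENNReal.div_le_div_right (le_klDiv_rpcJointLaw_radialInput η hN hM) _

/-- `ENNReal.ofReal` truncates negative logarithms, hence the maximum with `0`. -/
theorem ofReal_log_div_ofReal_log_two (x : ℝ) :
    (ENNReal.ofReal (Real.log x) / ENNReal.ofReal (Real.log 2)).toReal =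
      max (Real.logb 2 x) 0 := by
  have h2 : 0 < Real.log 2 := Real.log_pos one_lt_two
  have h := max_div_div_right h2.le (Real.log x) 0
  rw [zero_div] at h
  rw [ENNReal.toReal_div, ENNReal.toReal_ofReal', ENNReal.toReal_ofReal h2.le, Real.logb, h]

theorem rpcCapacity_ne_top {η N P : ℝ} (hη : 0 < η) (hN : 0 < N) (hP : 0 < P) :
    rpcCapacity η N P ≠ ∞ := by
  refine ne_top_of_le_ne_top (ENNReal.div_ne_top ENNReal.ofReal_ne_top ?_)
    (rpcCapacity_le hη hN hP)
  simpa using Real.log_pos one_lt_two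

theorem logb_sub_three_mul_logb {A M P : ℝ} (hA : 0 < A) (hM : 0 < M) (hP : 0 < P) :
    Real.logb 2 (A * M ^ 3) - 3 * Real.logb 2 P = Real.logb 2 (A * (M / P) ^ 3) := by
  rw [show A * (M / P) ^ 3 = A * M ^ 3 / P ^ 3 by rw [div_pow]; ring,
    Real.logb_div (by positivity) (by positivity), Real.logb_pow]
  norm_num

theorem tendsto_outputMomentBound_div (η N : ℝ) :
    Tendsto (fun P => outputMomentBound η N P / P) atTop (𝓝 (η ^ (2 / 3 : ℝ))) := by
  have h1 : Tendsto (fun P : ℝ => P ^ (-(2 / 3) : ℝ)) atTop (𝓝 0) :=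
    tendsto_rpow_neg_atTop (by norm_num)
  have h2 : Tendsto (fun P : ℝ => (1 + N) * P⁻¹) atTop (𝓝 0) := by
    simpa using tendsto_inv_atTop_zero.const_mul (1 + N)
  have h3 : Tendsto (fun P : ℝ => η ^ (2 / 3 : ℝ) + P ^ (-(2 / 3) : ℝ) + P ^ (-(2 / 3) : ℝ) +
      (1 + N) * P⁻¹) atTop (𝓝 (η ^ (2 / 3 : ℝ))) := by
    simpa using ((tendsto_const_nhds.add h1).add h1).add h2
  refine h3.congr' ?_
  filter_upwards [eventually_gt_atTop 0] with P hP
  have h4 : P ^ (1 / 3 : ℝ) = P ^ (-(2 / 3) : ℝ) * P := by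
    rw [← Real.rpow_add_one hP.ne']
    norm_num
  rw [outputMomentBound, h4]
  field_simp
  ring

/-- The high-power asymptotics of the capacity. -/
theorem tendsto_rpcCapacity_sub {η N : ℝ} (hη : 0 < η) (hN : 0 < N) :
    Tendsto (fun P : ℝ => (rpcCapacity η N P).toReal - 3 * Real.logb 2 P) atTop
      (𝓝 (Real.logb 2 (2 * η ^ 2 * Real.exp 1 ^ 2 / (9 * N)))) := by
  set A := 2 * Real.exp 1 ^ 2 / (9 * N) with hA
  have hApos : 0 < A := by positivity
  have hc : (η ^ (2 / 3 : ℝ)) ^ 3 = η ^ 2 := by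
    rw [← Real.rpow_natCast, ← Real.rpow_mul hη.le, ← Real.rpow_two]
    norm_num
  have hl : 2 * η ^ 2 * Real.exp 1 ^ 2 / (9 * N) = A * (η ^ (2 / 3 : ℝ)) ^ 3 := by
    rw [hc, hA]
    ring
  have hA' : ∀ M : ℝ, 2 * Real.exp 1 ^ 2 * M ^ 3 / (9 * N) = A * M ^ 3 := fun M => by
    rw [hA]
    ring
  have hup : Tendsto (fun P => Real.logb 2 (A * (outputMomentBound η N P / P) ^ 3)) atTop
      (𝓝 (Real.logb 2 (A * (η ^ (2 / 3 : ℝ)) ^ 3))) :=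
    (((tendsto_outputMomentBound_div η N).pow 3).const_mul A).logb (by positivity)
  rw [hl]
  refine tendsto_of_tendsto_of_tendsto_of_le_of_le' tendsto_const_nhds hup ?_ ?_
  · filter_upwards [eventually_gt_atTop 0] with P hP
    have h := ENNReal.toReal_mono (rpcCapacity_ne_top hη hN hP) (le_rpcCapacity hη hN hP)
    rw [ofReal_log_div_ofReal_log_two, hA'] at h
    have h2 := logb_sub_three_mul_logb hApos (show 0 < η ^ (2 / 3 : ℝ) * P by positivity) hP
    rw [mul_div_cancel_right₀ _ hP.ne'] at h2
    have := le_max_left (Real.logb 2 (A * (η ^ (2 / 3 : ℝ) * P) ^ 3)) 0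
    linarith
  -- For large `P` the argument of the logarithm is at least `1`, so the truncation at `0` is
  -- inactive in the upper bound.
  · have hlarge : Tendsto (fun P : ℝ => A * (η ^ (2 / 3 : ℝ)) ^ 3 * P ^ 3) atTop atTop :=
      (tendsto_pow_atTop three_ne_zero).const_mul_atTop (by positivity)
    filter_upwards [eventually_gt_atTop 0, hlarge.eventually_ge_atTop 1] with P hP hP1
    have hM := outputMomentBound_pos hη hN hP
    have hle : η ^ (2 / 3 : ℝ) * P ≤ outputMomentBound η N P := by
      have : 0 ≤ P ^ (-(2 / 3) : ℝ) * P + (P ^ (1 / 3 : ℝ) + 1) + N := by positivity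
      rw [outputMomentBound]
      linarith
    have h1 : 1 ≤ A * outputMomentBound η N P ^ 3 := by
      calc 1 ≤ A * (η ^ (2 / 3 : ℝ)) ^ 3 * P ^ 3 := hP1
        _ = A * (η ^ (2 / 3 : ℝ) * P) ^ 3 := by ring
        _ ≤ _ := by gcongr
    have hne : ENNReal.ofReal
      (Real.log (2 * Real.exp 1 ^ 2 * outputMomentBound η N P ^ 3 / (9 * N))) /
        ENNReal.ofReal (Real.log 2) ≠ ∞ :=
      ENNReal.div_ne_top ENNReal.ofReal_ne_top (by simpa using Real.log_pos one_lt_two)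
    have h := ENNReal.toReal_mono hne (rpcCapacity_le hη hN hP)
    rw [ofReal_log_div_ofReal_log_two, hA', max_eq_left (Real.logb_nonneg one_lt_two h1)] at h
    rw [← logb_sub_three_mul_logb hApos hM hP]
    linarith

theorem isCapacityPreLog_of_tendsto_sub {C : ℝ → ℝ} {d l : ℝ}
    (h : Tendsto (fun P => C P - d * Real.logb 2 P) atTop (𝓝 l)) : IsCapacityPreLog C d := by
  have hlog : Tendsto (Real.logb 2) atTop atTop := Real.tendsto_logb_atTop one_lt_two
  have h1 : Tendsto (fun P => (C P - d * Real.logb 2 P) / Real.logb 2 P + d) atTop (𝓝 d) := by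
    simpa using (h.div_atTop hlog).add_const d
  refine h1.congr' ?_
  filter_upwards [hlog.eventually_gt_atTop 0] with P hP
  field_simp
  ring

theorem mainTheorem4 (η N : ℝ) (hη : 0 < η) (hN : 0 < N) :
    (∀ P : ℝ, 0 < P → rpcCapacity η N P ≠ ∞) ∧
    (∃ l : ℝ,
      Tendsto (fun P : ℝ => (rpcCapacity η N P).toReal - 3 * Real.logb 2 P) atTop (𝓝 l) ∧
      Real.logb 2 (2 * η ^ 2 * Real.exp 1 ^ 2 / (9 * N)) ≤ l ∧
      l ≤ Real.logb 2 (6 * η ^ 2 / N)) ∧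
    IsCapacityPreLog (fun P => (rpcCapacity η N P).toReal) 3 := by
  have h := tendsto_rpcCapacity_sub hη hN
  refine ⟨fun P hP => rpcCapacity_ne_top hη hN hP, ⟨_, h, le_rfl, ?_⟩,
    isCapacityPreLog_of_tendsto_sub h⟩
  refine Real.logb_le_logb_of_le one_lt_two (by positivity) ?_
  -- Comparing `2 e² / 9` with `6` is exactly this inequality.
  have he : Real.exp 1 ^ 2 ≤ 27 := by
    nlinarith [Real.exp_one_lt_d9, Real.exp_pos 1]
  rw [div_le_div_iff₀ (by positivity) hN]
  calc 2 * η ^ 2 * Real.exp 1 ^ 2 * N ≤ 2 * η ^ 2 * 27 * N := by gcongr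
    _ = 6 * η ^ 2 * (9 * N) := by ring
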